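/- **Setting.** For $N\ge 1$ observe $Y=f^*+\epsilon\in\mathbb R^N$, where $f^*\in\mathbb R^N$ and $\epsilon$ has i.i.d. $\mathcal N(0,\sigma^2)$ coordinates, with $\sigma>0$ known. For a partition $m$ of $\{1,\dots,N\}$ let $F_m\subset\mathbb R^N$ be the subspace of vectors that are constant on each part of $m$, let $d'_m$ be the number of parts of $m$ minus one, and let $d''_m$ be the number of $i\in\{1,\dots,N-1\}$ such that $i$ and $i+1$ lie in different parts of $m$ (the number of segments minus one). Let $S^2(n,k)$ be the number of partitions of $\{1,\dots,n\}$ into $k$ non-empty parts in which any two distinct elements of the same part are at distance at least $2$. Put $$p_m=\frac{\exp(-d'_m-d''_m)}{B_N\,S^2(d''_m+1,d'_m+1)\binom{N}{d''_m}},\qquad \mathrm{pen}(m)=2\ln\frac1{p_m}+(d'_m+1)\ln\frac{N}{d'_m},$$ where $B_N$ is the constant for which the $p_m$ sum to $1$ over all partitions of $\{1,\dots,N\}$, and $\mathrm{pen}(m)=+\infty$ if $d'_m=0$. Let $\mathcal M=\{m: e\,d'_m\le N\}$, take $a=2$, $K=3a=6$, and let $\hat m$ be a (measurable) random element with $$\hat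 m\in\arg\min_{m\in\mathcal M}\ \|Y-\mathrm{Proj}_{F_m}Y\|^2+\sigma^2K\,\mathrm{pen}(m),\qquad \hat f_{\hat m}=\mathrm{Proj}_{F_{\hat m}}Y .$$ **Statement.** (1) *Adaptation and risk upper bound.* If $f^*\in F_{m^*}$ for some $m^*\in\mathcal M$ with $d'_{m^*}\ge1$, then, writing $d'=d'_{m^*}$ and $d''=d''_{m^*}$, the squared error $\|\hat f_{\hat m}-f^*\|^2$ is integrable and $$\mathbb E\|\hat f_{\hat m}-f^*\|^2\le 4\sigma^2\Big(7+3(d'+1)\ln\frac N{d'}+6\Big(d'\ln\big(d''e^{13/6}\big)+d''\ln\big(d'e^2\big)+d''\ln\frac N{d''}\Big)\Big).$$ (2) *Consistency.* Fix $\sigma$ and for every $N$ let $f^*=f^*_N\in\mathbb R^N$ and let $m^*=m^*_N$ be a partition of $\{1,\dots,N\}$ with $f^*_N\in F_{m^*_N}$. If $d''_{m^*_N}=o(N/\ln N)$ as $N\to\infty$, then the squared error is integrable for every $N$ and $$\lim_{N\to\infty}\frac1N\,\mathbb E\|\hat f_{\hat m}-f^*\|^2=0 .$$ -/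

import Mathlib

open MeasureTheory ProbabilityTheory Filter Topology Asymptotics
open scoped NNReal

noncomputable section

namespace ChangeCluster

/-- A model on `N` design points: a partition of the set of design points (indexed from `0`). -/
abbrev Model (N : ℕ) : Type := Finpartition (Finset.univ : Finset (Fin N))

/-- `ℝ^N` with its Euclidean norm. -/
abbrev Signal (N : ℕ) : Type := EuclideanSpace ℝ (Fin N)

/-- The subspace `F_m` of signals that are constant on every part of the partition `m`. -/
def modelSpace {N : ℕ} (m : Model N) : Submodule ℝ (Signal N) where
  carrier := {f | ∀ A ∈ m.parts, ∀ i ∈ A, ∀ j ∈ A, f i = f j}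
  add_mem' := by
    intro f g hf hg A hA i hi j hj
    simp only [PiLp.add_apply, hf A hA i hi j hj, hg A hA i hi j hj]
  zero_mem' := by
    intro A _ i _ j _
    simp only [PiLp.zero_apply]
  smul_mem' := by
    intro c f hf A hA i hi j hj
    simp only [PiLp.smul_apply, hf A hA i hi j hj]

/-- The clustering dimension `d'_m`: the number of parts, minus one. -/
def clusterDim {N : ℕ} (m : Model N) : ℕ := m.parts.card - 1

/-- The change points of `m`: the last elements of the maximal intervals contained in a part
(the segments), except the last design point; that is, the points whose successor exists and lies
in a different part. -/
def changePoints {N : ℕ} (m : Model N) : Finset (Fin N) :=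
  {i | ∃ j : Fin N, (j : ℕ) = i + 1 ∧ m.part i ≠ m.part j}

/-- The change-point dimension `d''_m`: the number of change points, that is, the number of
segments minus one. -/
def changeDim {N : ℕ} (m : Model N) : ℕ := (changePoints m).card

/-- `S²(n, k)`: the number of partitions of `n` consecutive integers into `k` non-empty parts such
that two distinct elements of the same part are at distance at least two. -/
def stirlingSq (n k : ℕ) : ℕ :=
  Fintype.card {Q : Finpartition (Finset.univ : Finset (Fin n)) //
    Q.parts.card = k ∧ ∀ A ∈ Q.parts, ∀ i ∈ A, ∀ j ∈ A, i < j → (i : ℕ) + 2 ≤ j}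

/-- The unnormalised prior weight
`exp (-d'_m - d''_m) / (S²(d''_m + 1, d'_m + 1) * C(N, d''_m))`. -/
def priorWeight {N : ℕ} (m : Model N) : ℝ :=
  Real.exp (-(clusterDim m : ℝ) - (changeDim m : ℝ)) /
    ((stirlingSq (changeDim m + 1) (clusterDim m + 1) : ℝ) * (N.choose (changeDim m) : ℝ))

/-- The normalising constant `B_N`, which makes the prior a probability mass function on the set
of all partitions. -/
def priorConst (N : ℕ) : ℝ := ∑ m : Model N, priorWeight m

/-- The prior probability `p_m`. -/
def prior {N : ℕ} (m : Model N) : ℝ := priorWeight m / priorConst N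

/-- The penalty `2 ln (1 / p_m) + (d'_m + 1) ln (N / d'_m)`; it is `+∞` if `d'_m = 0`. -/
def pen {N : ℕ} (m : Model N) : EReal :=
  if clusterDim m = 0 then ⊤
  else ((2 * Real.log (1 / prior m) +
    ((clusterDim m : ℝ) + 1) * Real.log ((N : ℝ) / (clusterDim m : ℝ)) : ℝ) : EReal)

/-- The projection (least squares) estimator attached to the model `m` and the data `y`. -/
def projEst {N : ℕ} (m : Model N) (y : Signal N) : Signal N := (modelSpace m).starProjection y

/-- The penalised criterion `‖y - Proj_{F_m} y‖² + σ² K pen(m)`. -/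
def crit {N : ℕ} (σ K : ℝ) (y : Signal N) (m : Model N) : EReal :=
  ((‖y - projEst m y‖ ^ 2 : ℝ) : EReal) + ((σ ^ 2 * K : ℝ) : EReal) * pen m

/-- The collection of candidate models: the partitions with `e d'_m ≤ N`. -/
def candidates (N : ℕ) : Set (Model N) := {m | Real.exp 1 * (clusterDim m : ℝ) ≤ (N : ℝ)}

/-- `m` minimises the penalised criterion over the candidate models. -/
def IsSelected {N : ℕ} (σ K : ℝ) (y : Signal N) (m : Model N) : Prop :=
  m ∈ candidates N ∧ ∀ m' ∈ candidates N, crit σ K y m ≤ crit σ K y m'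

/-- `ε` is a random vector of `N` independent centred Gaussian variables of variance `σ²`. -/
def IsGaussianNoise {Ω : Type*} [MeasurableSpace Ω] (P : Measure Ω) {N : ℕ} (σ : ℝ)
    (ε : Ω → Signal N) : Prop :=
  iIndepFun (fun (i : Fin N) (ω : Ω) => ε ω i) P ∧
    ∀ i : Fin N, HasLaw (fun ω => ε ω i) (gaussianReal 0 ((σ ^ 2).toNNReal)) P

/-- `mhat` is a (measurable) random model that, for every outcome, minimises over the candidate
models the penalised criterion with constant `K` evaluated at the data `Y`. Measurability is
understood up to null sets. -/
def IsSelector {Ω : Type*} [MeasurableSpace Ω] (P : Measure Ω) {N : ℕ} (σ K : ℝ)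
    (Y : Ω → Signal N) (mhat : Ω → Model N) : Prop :=
  (∀ m : Model N, NullMeasurableSet (mhat ⁻¹' {m}) P) ∧ ∀ ω, IsSelected σ K (Y ω) (mhat ω)

/-- The squared error `‖Proj_{F_{mhat}} Y - fstar‖²` of the selected estimator. -/
def sqError {Ω : Type*} {N : ℕ} (fstar : Signal N) (Y : Ω → Signal N) (mhat : Ω → Model N)
    (ω : Ω) : ℝ :=
  ‖projEst (mhat ω) (Y ω) - fstar‖ ^ 2

end ChangeCluster

end

namespace ChangeCluster

/-! ### Counting partitions -/

/-! This is the penalised least squares argument. Comparing the criterion at the selected model `m`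
with that at `mstar`, and projecting the noise onto `F_m + ℝ f`, which contains the estimation
error, bounds the squared error by `4 ‖Π ε‖²` plus `12 σ²` times the difference of the penalties
(`sq_norm_projEst_sub_le`). The random model is removed by `x ≤ exp (x - 1)` and a sum over all
candidates with finite penalty.

The expectation of that sum factorises. The exponential moment of `‖Π ε‖² / (6 σ²)` is `√(3/2)` to
the dimension, which is at most `d' + 2` (`IsGaussianNoise.integral_exp_norm_sq`,
`finrank_extendedSpace_le`), while `exp (-pen / 2)` is at most `p_m exp (-(d' + 1) / 2)`. Since `3/2
< e`, the second factor beats the first, and since the `p_m` sum to one the remainder is an absolute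
constant times `σ²` (`integral_sqError_le_penReal`).

The rest is counting, to make the penalty explicit. A model is determined by its change points and a
separated partition of its segments, so `card_models_le` gives `B_N ≤ e` through two geometric
series, and `stirlingSq_le` bounds the separated partitions by proper colourings of a path.

For consistency the explicit bound is `O(d'' ln N)` (`riskBound_le`). A true model with a single
part has infinite penalty, so it is first refined at the cost of at most one change point
(`exists_modelSpace_le`). -/

lemma card_image_le_of_factor {α β γ : Type*} [Fintype α] [DecidableEq β] [DecidableEq γ]
    (f : α → β) (g : α → γ) (h : ∀ i j, f i = f j → g i = g j) :
    (Finset.univ.image g).card ≤ (Finset.univ.image f).card := by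
  classical
  cases isEmpty_or_nonempty α
  · simp
  have : Finset.univ.image g = (Finset.univ.image f).image (fun b => g (Function.invFun f b)) := by
    rw [Finset.image_image]
    refine Finset.image_congr fun i _ => ?_
    exact h _ _ (Function.invFun_eq (f := f) ⟨i, rfl⟩).symm
  rw [this]
  exact Finset.card_image_le

lemma card_image_eq_of_iff {α β γ : Type*} [Fintype α] [DecidableEq β] [DecidableEq γ]
    (f : α → β) (g : α → γ) (h : ∀ i j, f i = f j ↔ g i = g j) :
    (Finset.univ.image g).card = (Finset.univ.image f).card :=
  le_antisymm (card_image_le_of_factor f g fun i j => (h i j).1)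
    (card_image_le_of_factor g f fun i j => (h i j).2)

section Univ

variable {α : Type*} [Fintype α] [DecidableEq α]

lemma parts_eq_image_part (P : Finpartition (Finset.univ : Finset α)) :
    P.parts = Finset.univ.image P.part := by
  ext A
  simp only [Finset.mem_image, Finset.mem_univ, true_and]
  constructor
  · intro hA
    obtain ⟨i, hi⟩ := P.nonempty_of_mem_parts hA
    exact ⟨i, P.part_eq_of_mem hA hi⟩
  · rintro ⟨i, rfl⟩
    exact P.part_mem.2 (Finset.mem_univ i)

lemma finpartition_ext_part {P Q : Finpartition (Finset.univ : Finset α)}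
    (h : ∀ i j, P.part i = P.part j ↔ Q.part i = Q.part j) : P = Q := by
  have hp : P.part = Q.part := by
    funext i
    ext j
    rw [P.mem_part_iff_part_eq_part (Finset.mem_univ _) (Finset.mem_univ _),
      Q.mem_part_iff_part_eq_part (Finset.mem_univ _) (Finset.mem_univ _)]
    exact h _ _
  refine Finpartition.ext ?_
  rw [parts_eq_image_part, parts_eq_image_part, hp]

lemma exists_finpartition_part_iff {β : Type*} [DecidableEq β] (g : α → β) :
    ∃ Q : Finpartition (Finset.univ : Finset α), ∀ i j, Q.part i = Q.part j ↔ g i = g j := by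
  classical
  refine ⟨Finpartition.ofSetoid (Setoid.ker g), fun i j => ?_⟩
  rw [← Finpartition.mem_part_iff_part_eq_part _ (Finset.mem_univ _) (Finset.mem_univ _),
    Finpartition.mem_part_ofSetoid_iff_rel]
  exact eq_comm

lemma eq_part_of_mem {P : Finpartition (Finset.univ : Finset α)} {A : Finset α} (hA : A ∈ P.parts)
    {i j : α} (hi : i ∈ A) (hj : j ∈ A) : P.part i = P.part j := by
  rw [P.part_eq_of_mem hA hi, P.part_eq_of_mem hA hj]

end Univ

lemma parts_card_pos {N : ℕ} (hN : 0 < N) (m : Model N) : 0 < m.parts.card := by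
  rw [Finset.card_pos]
  exact ⟨m.part ⟨0, hN⟩, m.part_mem.2 (Finset.mem_univ _)⟩

lemma parts_card_eq {N : ℕ} (hN : 0 < N) (m : Model N) :
    m.parts.card = clusterDim m + 1 := by
  have := parts_card_pos hN m
  unfold clusterDim
  omega

/-- The number of elements of `C` below `k`; if `C` is the set of change points of a model, this is
the rank of the segment which contains `k`. -/
def segRank {N : ℕ} (C : Finset (Fin N)) (k : ℕ) : ℕ := (C.filter fun c : Fin N => (c : ℕ) < k).card

lemma segRank_le {N : ℕ} (C : Finset (Fin N)) (k : ℕ) : segRank C k ≤ C.card :=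
  Finset.card_filter_le _ _

lemma segRank_zero {N : ℕ} (C : Finset (Fin N)) : segRank C 0 = 0 := by
  simp [segRank]

lemma segRank_mono {N : ℕ} (C : Finset (Fin N)) : Monotone (segRank C) := by
  intro k l h
  refine Finset.card_le_card fun c hc => ?_
  simp only [Finset.mem_filter] at hc ⊢
  exact ⟨hc.1, by omega⟩

lemma segRank_succ_of_mem {N : ℕ} {C : Finset (Fin N)} {c : Fin N} (hc : c ∈ C) :
    segRank C ((c : ℕ) + 1) = segRank C c + 1 := by
  have : (C.filter fun d : Fin N => (d : ℕ) < (c : ℕ) + 1) =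
      insert c (C.filter fun d : Fin N => (d : ℕ) < (c : ℕ)) := by
    ext d
    simp only [Finset.mem_filter, Finset.mem_insert, Fin.ext_iff]
    constructor
    · rintro ⟨h1, h2⟩
      by_cases h : (d : ℕ) = c
      · exact Or.inl h
      · exact Or.inr ⟨h1, by omega⟩
    · rintro (h | h)
      · have : d = c := Fin.ext h
        subst this
        exact ⟨hc, by omega⟩
      · exact ⟨h.1, by omega⟩
  rw [segRank, this, Finset.card_insert_of_notMem (by simp), segRank]

lemma segRank_succ_of_notMem {N : ℕ} {C : Finset (Fin N)} {k : ℕ}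
    (hk : ∀ c ∈ C, (c : ℕ) ≠ k) : segRank C (k + 1) = segRank C k := by
  unfold segRank
  congr 1
  refine Finset.filter_congr fun c hc => ?_
  have := hk c hc
  omega

/-- The rank starts at zero and increases only when passing an element of `C`, by exactly one, so it
can leave the level `s` only at an element of `C`. -/
lemma exists_mem_segRank_eq {N : ℕ} (C : Finset (Fin N)) (s : ℕ) :
    ∀ k, s < segRank C k → ∃ c ∈ C, segRank C (c : ℕ) = s := by
  intro k
  induction k with
  | zero => simp [segRank_zero]
  | succ k ih =>
    intro hs
    by_cases hk : ∃ c ∈ C, (c : ℕ) = k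
    · obtain ⟨c, hc, rfl⟩ := hk
      rw [segRank_succ_of_mem hc] at hs
      rcases Nat.lt_or_ge s (segRank C c) with h | h
      · exact ih h
      · exact ⟨c, hc, by omega⟩
    · push Not at hk
      rw [segRank_succ_of_notMem hk] at hs
      exact ih hs

lemma mem_changePoints {N : ℕ} {m : Model N} {i : Fin N} :
    i ∈ changePoints m ↔ ∃ j : Fin N, (j : ℕ) = i + 1 ∧ m.part i ≠ m.part j := by
  simp [changePoints]

/-- Equal ranks leave no room for a change point between `i` and `k`, so the part is carried along
from each point to its successor. -/
lemma part_eq_of_segRank_eq_of_le {N : ℕ} (m : Model N) (i : Fin N) :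
    ∀ k, (i : ℕ) ≤ k → ∀ hk : k < N,
      segRank (changePoints m) k = segRank (changePoints m) i → m.part ⟨k, hk⟩ = m.part i := by
  intro k hik
  induction k, hik using Nat.le_induction with
  | base => intro _ _; rfl
  | succ k hik ih =>
    intro hk hs
    have h1 := segRank_mono (changePoints m) hik
    have h2 := segRank_mono (changePoints m) (Nat.le_succ k)
    rw [Nat.succ_eq_add_one] at h2
    have hk' : k < N := by omega
    have hnot : (⟨k, hk'⟩ : Fin N) ∉ changePoints m := by
      intro hmem
      have := segRank_succ_of_mem hmem
      simp only at this
      omega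
    rw [← ih hk' (by omega)]
    by_contra hne
    exact hnot (mem_changePoints.2 ⟨⟨k + 1, hk⟩, rfl, fun h => hne h.symm⟩)

lemma part_eq_of_segRank_eq {N : ℕ} (m : Model N) {i j : Fin N}
    (h : segRank (changePoints m) i = segRank (changePoints m) j) : m.part i = m.part j := by
  rcases le_total (i : ℕ) j with hij | hij
  · exact (part_eq_of_segRank_eq_of_le m i j hij j.2 h.symm).symm
  · exact part_eq_of_segRank_eq_of_le m j i hij i.2 h

/-- A change point has a successor, so the last design point is never one and the strict count below
`N - 1` misses nothing. -/
lemma segRank_last {N : ℕ} (hN : 0 < N) (m : Model N) :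
    segRank (changePoints m) (N - 1) = changeDim m := by
  unfold segRank changeDim
  rw [Finset.filter_true_of_mem]
  intro c hc
  obtain ⟨j, hj, -⟩ := mem_changePoints.1 hc
  have := j.2
  omega

/-- The rank of a segment as an element of `Fin`. -/
def segIdx {N : ℕ} (C : Finset (Fin N)) (i : Fin N) : Fin (C.card + 1) :=
  ⟨segRank C i, Nat.lt_succ_of_le (segRank_le C i)⟩

lemma segIdx_surjective {N : ℕ} (hN : 0 < N) (m : Model N) :
    Function.Surjective (segIdx (changePoints m)) := by
  intro s
  have hlast := segRank_last hN m
  rcases Nat.lt_or_ge (s : ℕ) (changePoints m).card with h | h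
  · obtain ⟨c, -, hc⟩ := exists_mem_segRank_eq (changePoints m) s (N - 1) (by
      rw [hlast]; exact h)
    exact ⟨c, Fin.ext hc⟩
  · refine ⟨⟨N - 1, by omega⟩, Fin.ext ?_⟩
    have := s.2
    simp only [segIdx, hlast, changeDim]
    omega

/-- Two distinct elements of the same part are at distance at least two. -/
def IsSeparated {n : ℕ} (Q : Finpartition (Finset.univ : Finset (Fin n))) : Prop :=
  ∀ A ∈ Q.parts, ∀ i ∈ A, ∀ j ∈ A, i < j → (i : ℕ) + 2 ≤ j

/-- A model is described by its change points and the partition it induces on its segments. -/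
lemma exists_segment_partition {N : ℕ} (hN : 0 < N) (m : Model N) :
    ∃ Q : Finpartition (Finset.univ : Finset (Fin ((changePoints m).card + 1))),
      Q.parts.card = clusterDim m + 1 ∧ IsSeparated Q ∧
      ∀ i j : Fin N, m.part i = m.part j ↔
        Q.part (segIdx (changePoints m) i) = Q.part (segIdx (changePoints m) j) := by
  -- One representative per segment suffices, because the part is constant on a segment; `Q` groups
  -- the segments by the part of their representatives.
  obtain ⟨rep, hrep⟩ := (segIdx_surjective hN m).hasRightInverse
  obtain ⟨Q, hQ⟩ := exists_finpartition_part_iff (fun s => m.part (rep s))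
  have hseg : ∀ i, m.part (rep (segIdx (changePoints m) i)) = m.part i := by
    intro i
    apply part_eq_of_segRank_eq
    exact congrArg Fin.val (hrep (segIdx (changePoints m) i))
  have hiff : ∀ i j : Fin N, m.part i = m.part j ↔
      Q.part (segIdx (changePoints m) i) = Q.part (segIdx (changePoints m) j) := by
    intro i j
    rw [hQ, hseg, hseg]
  refine ⟨Q, ?_, ?_, hiff⟩
  · rw [← parts_card_eq hN, parts_eq_image_part m, parts_eq_image_part Q,
      card_image_eq_of_iff (fun i => Q.part (segIdx (changePoints m) i)) m.part
        (fun i j => (hiff i j).symm)]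
    have : (Finset.univ.image fun i => Q.part (segIdx (changePoints m) i)) =
        (Finset.univ.image (segIdx (changePoints m))).image Q.part := by
      rw [Finset.image_image]
      rfl
    rw [this, Finset.image_univ_of_surjective (segIdx_surjective hN m)]
  -- If `s` and `s + 1` shared a part of `Q`, the change point that ends segment `s` would lie in
  -- the same part of `m` as its successor.
  · intro A hA s hs t ht hst
    by_contra hlt
    have hst' : (t : ℕ) = s + 1 := by
      have : (s : ℕ) < t := hst
      omega
    obtain ⟨c, hc, hcs⟩ := exists_mem_segRank_eq (changePoints m) s (N - 1) (by
      rw [segRank_last hN m]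
      have := t.2
      unfold changeDim
      omega)
    have hsucc := segRank_succ_of_mem hc
    obtain ⟨j, hj, hne⟩ := mem_changePoints.1 hc
    rw [← hj] at hsucc
    apply hne
    have e1 : segIdx (changePoints m) c = s := Fin.ext hcs
    have e2 : segIdx (changePoints m) j = t := Fin.ext (by
      simp only [segIdx]; omega)
    rw [hiff, e1, e2]
    exact eq_part_of_mem hA hs ht

lemma stirlingSq_pos {N : ℕ} (hN : 0 < N) (m : Model N) :
    0 < stirlingSq (changeDim m + 1) (clusterDim m + 1) := by
  obtain ⟨Q, h1, h2, -⟩ := exists_segment_partition hN m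
  exact Fintype.card_pos_iff.2 ⟨⟨Q, h1, h2⟩⟩

lemma clusterDim_le_changeDim {N : ℕ} (hN : 0 < N) (m : Model N) :
    clusterDim m ≤ changeDim m := by
  obtain ⟨Q, h1, -, -⟩ := exists_segment_partition hN m
  have := Q.card_parts_le_card
  rw [h1, Finset.card_univ, Fintype.card_fin] at this
  unfold changeDim
  omega

lemma changeDim_le {N : ℕ} (m : Model N) : changeDim m ≤ N := by
  simpa [changeDim] using Finset.card_le_univ (changePoints m)

/-- With `C` fixed, `segIdx C` is fixed too, so the segment partition recovers the whole equivalence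
relation of the model: the assignment is injective. -/
lemma card_models_with_changePoints_le {N : ℕ} (hN : 0 < N) (C : Finset (Fin N)) (k : ℕ) :
    (Finset.univ.filter fun m : Model N => changePoints m = C ∧ clusterDim m = k).card ≤
      stirlingSq (C.card + 1) (k + 1) := by
  classical
  have key : ∀ m : Model N, changePoints m = C ∧ clusterDim m = k →
      ∃ Q : {Q : Finpartition (Finset.univ : Finset (Fin (C.card + 1))) //
        Q.parts.card = k + 1 ∧ ∀ A ∈ Q.parts, ∀ i ∈ A, ∀ j ∈ A, i < j → (i : ℕ) + 2 ≤ j},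
        ∀ i j : Fin N, m.part i = m.part j ↔ Q.1.part (segIdx C i) = Q.1.part (segIdx C j) := by
    rintro m ⟨rfl, rfl⟩
    obtain ⟨Q, h1, h2, h3⟩ := exists_segment_partition hN m
    exact ⟨⟨Q, h1, h2⟩, h3⟩
  choose F hF using key
  rw [stirlingSq, ← Fintype.card_coe]
  refine Fintype.card_le_of_injective
    (fun m => F m.1 (Finset.mem_filter.1 m.2).2) ?_
  rintro ⟨m, hm⟩ ⟨m', hm'⟩ h
  simp only at h
  refine Subtype.ext (finpartition_ext_part fun i j => ?_)
  rw [hF m (Finset.mem_filter.1 hm).2, hF m' (Finset.mem_filter.1 hm').2, h]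

lemma card_models_le {N : ℕ} (hN : 0 < N) (k n : ℕ) :
    (Finset.univ.filter fun m : Model N => clusterDim m = k ∧ changeDim m = n).card ≤
      stirlingSq (n + 1) (k + 1) * N.choose n := by
  classical
  have hsub : (Finset.univ.filter fun m : Model N => clusterDim m = k ∧ changeDim m = n) ⊆
      (Finset.powersetCard n (Finset.univ : Finset (Fin N))).biUnion fun C =>
        Finset.univ.filter fun m : Model N => changePoints m = C ∧ clusterDim m = k := by
    intro m hm
    simp only [Finset.mem_filter, Finset.mem_univ, true_and, Finset.mem_biUnion,
      Finset.mem_powersetCard, Finset.subset_univ] at hm ⊢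
    exact ⟨changePoints m, hm.2, rfl, hm.1⟩
  refine (Finset.card_le_card hsub).trans (Finset.card_biUnion_le.trans ?_)
  have : ∀ C ∈ Finset.powersetCard n (Finset.univ : Finset (Fin N)),
      (Finset.univ.filter fun m : Model N => changePoints m = C ∧ clusterDim m = k).card ≤
        stirlingSq (n + 1) (k + 1) := by
    intro C hC
    have hc := (Finset.mem_powersetCard.1 hC).2
    have := card_models_with_changePoints_le hN C k
    rwa [hc] at this
  refine (Finset.sum_le_card_nsmul _ _ _ this).trans ?_
  rw [Finset.card_powersetCard, Finset.card_univ, Fintype.card_fin, smul_eq_mul, mul_comm]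

/-- A colouring is recovered from its first colour and its successive differences in the cyclic
group `Fin (k + 1)`; properness says that the `n` differences are nonzero. -/
lemma card_proper_colorings_le (n k : ℕ) :
    Fintype.card {q : Fin (n + 1) → Fin (k + 1) // ∀ i : Fin n, q i.castSucc ≠ q i.succ} ≤
      (k + 1) * k ^ n := by
  classical
  have hcard : Fintype.card (Fin (k + 1) × (Fin n → {x : Fin (k + 1) // x ≠ 0})) =
      (k + 1) * k ^ n := by
    simp
  rw [← hcard]
  refine Fintype.card_le_of_injective
    (fun q => (q.1 0, fun i => ⟨q.1 i.succ - q.1 i.castSucc, sub_ne_zero.2 (q.2 i).symm⟩)) ?_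
  rintro ⟨q, hq⟩ ⟨q', hq'⟩ h
  simp only [Prod.mk.injEq] at h
  refine Subtype.ext (funext fun i => ?_)
  induction i using Fin.induction with
  | zero => exact h.1
  | succ i ih =>
    have := congrArg Subtype.val (congrFun h.2 i)
    simp only at this ih
    rw [ih] at this
    simpa using this

/-- Numbering the parts arbitrarily turns a separated partition into a proper colouring of a path,
and the colour classes give the partition back. -/
lemma stirlingSq_le (n k : ℕ) : stirlingSq (n + 1) (k + 1) ≤ (k + 1) * k ^ n := by
  classical
  refine le_trans ?_ (card_proper_colorings_le n k)
  have key : ∀ Q : {Q : Finpartition (Finset.univ : Finset (Fin (n + 1))) //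
      Q.parts.card = k + 1 ∧ ∀ A ∈ Q.parts, ∀ i ∈ A, ∀ j ∈ A, i < j → (i : ℕ) + 2 ≤ j},
      ∃ q : {q : Fin (n + 1) → Fin (k + 1) // ∀ i : Fin n, q i.castSucc ≠ q i.succ},
        ∀ i j, Q.1.part i = Q.1.part j ↔ q.1 i = q.1 j := by
    rintro ⟨Q, h1, h2⟩
    let e := Q.parts.equivFinOfCardEq h1
    have hm : ∀ i, Q.part i ∈ Q.parts := fun i => Q.part_mem.2 (Finset.mem_univ i)
    have hiff : ∀ i j, Q.part i = Q.part j ↔ e ⟨Q.part i, hm i⟩ = e ⟨Q.part j, hm j⟩ := by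
      intro i j
      rw [e.apply_eq_iff_eq, Subtype.mk.injEq]
    refine ⟨⟨fun i => e ⟨Q.part i, hm i⟩, fun i hi => ?_⟩, hiff⟩
    have hp := (hiff _ _).2 hi
    have h3 : i.castSucc ∈ Q.part i.castSucc := Q.mem_part_self.2 (Finset.mem_univ _)
    have h4 : i.succ ∈ Q.part i.castSucc := by
      rw [hp]; exact Q.mem_part_self.2 (Finset.mem_univ _)
    have := h2 _ (hm i.castSucc) _ h3 _ h4 (Fin.castSucc_lt_succ)
    simp at this
  choose F hF using key
  refine Fintype.card_le_of_injective F fun Q Q' h => ?_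
  refine Subtype.ext (finpartition_ext_part fun i j => ?_)
  rw [hF, hF, h]

/-! ### The prior -/

lemma priorWeight_pos {N : ℕ} (hN : 0 < N) (m : Model N) : 0 < priorWeight m := by
  have h1 := stirlingSq_pos hN m
  have h2 := Nat.choose_pos (changeDim_le m)
  unfold priorWeight
  positivity

lemma priorConst_pos {N : ℕ} (hN : 0 < N) : 0 < priorConst N :=
  Finset.sum_pos (fun m _ => priorWeight_pos hN m) ⟨⊤, Finset.mem_univ _⟩

lemma prior_pos {N : ℕ} (hN : 0 < N) (m : Model N) : 0 < prior m :=
  div_pos (priorWeight_pos hN m) (priorConst_pos hN)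

lemma sum_prior {N : ℕ} (hN : 0 < N) : ∑ m : Model N, prior m = 1 := by
  unfold prior
  rw [← Finset.sum_div]
  exact div_self (priorConst_pos hN).ne'

lemma sum_priorWeight_fiber_le {N : ℕ} (hN : 0 < N) (k n : ℕ) :
    ∑ m : Model N with clusterDim m = k ∧ changeDim m = n, priorWeight m ≤
      Real.exp (-1) ^ k * Real.exp (-1) ^ n := by
  have hval : ∀ m ∈ Finset.univ.filter fun m : Model N => clusterDim m = k ∧ changeDim m = n,
      priorWeight m = Real.exp (-1) ^ k * Real.exp (-1) ^ n /
        ((stirlingSq (n + 1) (k + 1) : ℝ) * (N.choose n : ℝ)) := by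
    intro m hm
    obtain ⟨rfl, rfl⟩ := (Finset.mem_filter.1 hm).2
    unfold priorWeight
    congr 1
    rw [← Real.exp_nat_mul, ← Real.exp_nat_mul, ← Real.exp_add]
    congr 1
    ring
  rw [Finset.sum_congr rfl hval, Finset.sum_const, nsmul_eq_mul, mul_div_assoc']
  -- The denominator may vanish for pairs `(k, n)` that no model attains; this form of the division
  -- bound needs only nonnegativity.
  refine div_le_of_le_mul₀ (by positivity) (by positivity) ?_
  rw [mul_comm]
  refine mul_le_mul_of_nonneg_left ?_ (by positivity)
  exact_mod_cast card_models_le hN k n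

lemma geom_sum_exp_neg_one_le (n : ℕ) :
    ∑ k ∈ Finset.range n, Real.exp (-1) ^ k ≤ (1 - Real.exp (-1))⁻¹ := by
  have h1 : Real.exp (-1) < 1 := by
    rw [← Real.exp_zero]
    exact Real.exp_lt_exp.2 (by norm_num)
  rw [← tsum_geometric_of_lt_one (Real.exp_pos _).le h1]
  exact (summable_geometric_of_lt_one (Real.exp_pos _).le h1).sum_le_tsum _
    fun _ _ => by positivity

lemma priorConst_le {N : ℕ} (hN : 0 < N) : priorConst N ≤ Real.exp 1 := by
  have hmaps : ∀ m ∈ (Finset.univ : Finset (Model N)),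
      (clusterDim m, changeDim m) ∈ Finset.range (N + 1) ×ˢ Finset.range (N + 1) := by
    intro m _
    have h1 := clusterDim_le_changeDim hN m
    have h2 := changeDim_le m
    simp only [Finset.mem_product, Finset.mem_range]
    omega
  have hg := geom_sum_exp_neg_one_le (N + 1)
  have hg0 : 0 ≤ ∑ k ∈ Finset.range (N + 1), Real.exp (-1) ^ k :=
    Finset.sum_nonneg fun _ _ => by positivity
  calc priorConst N
      = ∑ p ∈ Finset.range (N + 1) ×ˢ Finset.range (N + 1),
          ∑ m : Model N with (clusterDim m, changeDim m) = p, priorWeight m :=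
        (Finset.sum_fiberwise_of_maps_to hmaps _).symm
    _ ≤ ∑ p ∈ Finset.range (N + 1) ×ˢ Finset.range (N + 1),
          Real.exp (-1) ^ p.1 * Real.exp (-1) ^ p.2 := by
        refine Finset.sum_le_sum fun p _ => ?_
        refine le_trans (le_of_eq ?_) (sum_priorWeight_fiber_le hN p.1 p.2)
        simp only [Prod.ext_iff]
    _ = (∑ k ∈ Finset.range (N + 1), Real.exp (-1) ^ k) *
          ∑ k ∈ Finset.range (N + 1), Real.exp (-1) ^ k := by
        rw [Finset.sum_mul_sum, Finset.sum_product]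
    _ ≤ (1 - Real.exp (-1))⁻¹ * (1 - Real.exp (-1))⁻¹ := mul_le_mul hg hg hg0 (hg0.trans hg)
    -- This amounts to `e ≤ (e - 1)²`.
    _ ≤ Real.exp 1 := by
        have he := Real.exp_one_gt_d9
        rw [Real.exp_neg]
        set e := Real.exp 1
        have h1 : (1 - e⁻¹)⁻¹ = e / (e - 1) := by
          have : e - 1 ≠ 0 := by linarith
          have : e ≠ 0 := by linarith
          field_simp
        rw [h1, div_mul_div_comm, div_le_iff₀ (by nlinarith)]
        nlinarith

/-- This is `C(N, n) ≤ N ^ n / n! ≤ (e N / n) ^ n`, using that `n ^ n / n!` is a single term of the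
series of `exp n`. -/
lemma log_choose_le {N n : ℕ} (hn : 0 < n) (hnN : n ≤ N) :
    Real.log (N.choose n) ≤ n * Real.log ((N : ℝ) / n) + n := by
  have hn' : (0 : ℝ) < n := by exact_mod_cast hn
  have hN' : (0 : ℝ) < N := by exact_mod_cast hn.trans_le hnN
  have h1 : (N.choose n : ℝ) ≤ ((N : ℝ) / n) ^ n * Real.exp n := by
    calc (N.choose n : ℝ) ≤ (N : ℝ) ^ n / (n.factorial : ℝ) := Nat.choose_le_pow_div n N
      _ = ((N : ℝ) / n) ^ n * ((n : ℝ) ^ n / n.factorial) := by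
          rw [div_pow]; field_simp
      _ ≤ ((N : ℝ) / n) ^ n * Real.exp n := by
          gcongr
          exact Real.pow_div_factorial_le_exp _ hn'.le _
  have h2 : (0 : ℝ) < N.choose n := by exact_mod_cast Nat.choose_pos hnN
  refine (Real.log_le_log h2 h1).trans_eq ?_
  rw [Real.log_mul (by positivity) (by positivity), Real.log_exp, Real.log_pow]

lemma log_stirlingSq_le {n k : ℕ} (hk : 0 < k) (hpos : 0 < stirlingSq (n + 1) (k + 1)) :
    Real.log (stirlingSq (n + 1) (k + 1)) ≤ k + n * Real.log k := by
  have hk' : (0 : ℝ) < k := by exact_mod_cast hk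
  have h1 : (stirlingSq (n + 1) (k + 1) : ℝ) ≤ ((k : ℝ) + 1) * (k : ℝ) ^ n := by
    exact_mod_cast stirlingSq_le n k
  refine (Real.log_le_log (by exact_mod_cast hpos) h1).trans ?_
  rw [Real.log_mul (by positivity) (by positivity), Real.log_pow]
  have := Real.log_le_sub_one_of_pos (show (0 : ℝ) < k + 1 by positivity)
  linarith

lemma log_one_div_prior_le {N : ℕ} (m : Model N) (hm : 1 ≤ clusterDim m) (hN : 0 < N) :
    Real.log (1 / prior m) ≤ 1 + 2 * (clusterDim m : ℝ) + 2 * (changeDim m : ℝ)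
      + (changeDim m : ℝ) * Real.log (clusterDim m)
      + (changeDim m : ℝ) * Real.log ((N : ℝ) / changeDim m) := by
  have hS := stirlingSq_pos hN m
  have hC := Nat.choose_pos (changeDim_le m)
  have hd := clusterDim_le_changeDim hN m
  have hB := priorConst_pos hN
  have hS' : (stirlingSq (changeDim m + 1) (clusterDim m + 1) : ℝ) ≠ 0 := by exact_mod_cast hS.ne'
  have hC' : (N.choose (changeDim m) : ℝ) ≠ 0 := by exact_mod_cast hC.ne'
  have e1 : Real.log (1 / prior m) = Real.log (priorConst N) + clusterDim m + changeDim m +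
      Real.log (stirlingSq (changeDim m + 1) (clusterDim m + 1)) +
      Real.log (N.choose (changeDim m)) := by
    rw [prior, one_div_div, Real.log_div hB.ne' (priorWeight_pos hN m).ne', priorWeight,
      Real.log_div (Real.exp_pos _).ne' (mul_ne_zero hS' hC'), Real.log_exp,
      Real.log_mul hS' hC']
    ring
  have h1 : Real.log (priorConst N) ≤ 1 := by
    rw [← Real.log_exp 1]
    exact Real.log_le_log hB (priorConst_le hN)
  have h2 := log_stirlingSq_le hm hS
  have h3 := log_choose_le (show 0 < changeDim m by omega) (changeDim_le m)
  rw [e1]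
  linarith

/-- The value of the penalty where it is finite. -/
noncomputable def penReal {N : ℕ} (m : Model N) : ℝ :=
  2 * Real.log (1 / prior m) +
    ((clusterDim m : ℝ) + 1) * Real.log ((N : ℝ) / (clusterDim m : ℝ))

lemma pen_eq_top {N : ℕ} {m : Model N} (h : clusterDim m = 0) : pen m = ⊤ := by simp [pen, h]

lemma pen_eq_penReal {N : ℕ} {m : Model N} (h : clusterDim m ≠ 0) : pen m = (penReal m : EReal) := by
  simp [pen, h, penReal]

lemma penReal_le {N : ℕ} (m : Model N) (hm : 1 ≤ clusterDim m) (hN : 0 < N) :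
    6 * penReal m + 4 ≤ 2 * (7
      + 3 * ((clusterDim m : ℝ) + 1) * Real.log ((N : ℝ) / (clusterDim m : ℝ))
      + 6 * ((clusterDim m : ℝ) * Real.log ((changeDim m : ℝ) * Real.exp (13 / 6))
        + (changeDim m : ℝ) * Real.log ((clusterDim m : ℝ) * Real.exp 2)
        + (changeDim m : ℝ) * Real.log ((N : ℝ) / (changeDim m : ℝ)))) := by
  have hd := clusterDim_le_changeDim hN m
  have h1 : (1 : ℝ) ≤ clusterDim m := by exact_mod_cast hm
  have h2 : (1 : ℝ) ≤ changeDim m := by exact_mod_cast hm.trans hd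
  have hL := log_one_div_prior_le m hm hN
  -- The term `d' ln d''` of the target is only slack. The rest of the comparison is `16 + 24 d' ≤
  -- 14 + 26 d'`, where `26 = 12 * 13 / 6`; it holds because `d' ≥ 1`.
  have hlog : 0 ≤ (clusterDim m : ℝ) * Real.log (changeDim m) :=
    mul_nonneg (by linarith) (Real.log_nonneg h2)
  rw [Real.log_mul (by positivity) (by positivity), Real.log_mul (by positivity) (by positivity),
    Real.log_exp, Real.log_exp]
  unfold penReal
  nlinarith

/-- Half of `2 ln (1 / p_m)` returns exactly the factor `p_m`; the candidate condition `e d' ≤ N`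
makes the remaining logarithm at least one. -/
lemma exp_neg_half_penReal_le {N : ℕ} (m : Model N) (hm : 1 ≤ clusterDim m)
    (hc : m ∈ candidates N) (hN : 0 < N) :
    Real.exp (-(penReal m / 2)) ≤ prior m * Real.exp (-(((clusterDim m : ℝ) + 1) / 2)) := by
  have hk : (0 : ℝ) < clusterDim m := by exact_mod_cast hm
  have hlog : 1 ≤ Real.log ((N : ℝ) / clusterDim m) := by
    rw [← Real.log_exp 1]
    refine Real.log_le_log (Real.exp_pos _) ?_
    rw [le_div_iff₀ hk]
    exact hc
  have hp := prior_pos hN m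
  rw [← Real.exp_log hp, ← Real.exp_add, Real.exp_le_exp]
  unfold penReal
  rw [one_div, Real.log_inv]
  nlinarith

/-! ### Exponential moments of projected Gaussian noise -/

/-- The exponents combine as `-1/2 + 1/6 = -1/3`. The value `1/6` is the one that the constant `K =
6` demands later. -/
lemma gaussianPDFReal_mul_exp_sq (x : ℝ) :
    gaussianPDFReal 0 1 x * Real.exp (x ^ 2 / 6) =
      (√(2 * Real.pi))⁻¹ * Real.exp (-(1 / 3) * x ^ 2) := by
  rw [gaussianPDFReal_def, mul_assoc, ← Real.exp_add]
  simp only [NNReal.coe_one, mul_one, sub_zero]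
  congr 2
  ring

lemma integrable_exp_sq_gaussianReal :
    Integrable (fun x : ℝ => Real.exp (x ^ 2 / 6)) (gaussianReal 0 1) := by
  rw [gaussianReal_of_var_ne_zero _ one_ne_zero, integrable_withDensity_iff_integrable_smul'
    (measurable_gaussianPDF 0 1) (Filter.Eventually.of_forall fun _ => gaussianPDF_lt_top)]
  simp only [toReal_gaussianPDF, smul_eq_mul, gaussianPDFReal_mul_exp_sq]
  exact (integrable_exp_neg_mul_sq (by norm_num)).const_mul _

lemma integral_exp_sq_gaussianReal :
    ∫ x : ℝ, Real.exp (x ^ 2 / 6) ∂(gaussianReal 0 1) = √(3 / 2) := by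
  rw [integral_gaussianReal_eq_integral_smul one_ne_zero]
  simp only [smul_eq_mul, gaussianPDFReal_mul_exp_sq]
  rw [integral_const_mul, integral_gaussian, ← Real.sqrt_inv, ← Real.sqrt_mul (by positivity)]
  congr 1
  have := Real.pi_ne_zero
  field_simp

section StdGaussian

variable {E : Type*} [NormedAddCommGroup E] [InnerProductSpace ℝ E] [FiniteDimensional ℝ E]

lemma exp_norm_sq_sum_smul (x : Fin (Module.finrank ℝ E) → ℝ) :
    Real.exp (‖∑ i, x i • stdOrthonormalBasis ℝ E i‖ ^ 2 / 6) = ∏ i, Real.exp (x i ^ 2 / 6) := by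
  rw [← Real.exp_sum, ← Finset.sum_div]
  congr 2
  have h : (∑ i, x i • stdOrthonormalBasis ℝ E i) =
      (stdOrthonormalBasis ℝ E).repr.symm (WithLp.toLp 2 x) := by
    rw [OrthonormalBasis.sum_repr_symm]
  rw [h, LinearIsometryEquiv.norm_map, EuclideanSpace.norm_sq_eq]
  simp

variable [MeasurableSpace E] [BorelSpace E]

lemma integrable_exp_norm_sq_stdGaussian :
    Integrable (fun x : E => Real.exp (‖x‖ ^ 2 / 6)) (stdGaussian E) := by
  rw [stdGaussian, integrable_map_measure (by fun_prop) (Measurable.aemeasurable (by fun_prop))]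
  simp only [Function.comp_def, exp_norm_sq_sum_smul]
  exact Integrable.fintype_prod (f := fun _ y => Real.exp (y ^ 2 / 6))
    fun _ => integrable_exp_sq_gaussianReal

lemma integral_exp_norm_sq_stdGaussian :
    ∫ x : E, Real.exp (‖x‖ ^ 2 / 6) ∂(stdGaussian E) = √(3 / 2) ^ Module.finrank ℝ E := by
  rw [stdGaussian, integral_map (Measurable.aemeasurable (by fun_prop)) (by fun_prop)]
  simp only [exp_norm_sq_sum_smul]
  rw [integral_fintype_prod_eq_prod (fun _ y => Real.exp (y ^ 2 / 6))]
  rw [Finset.prod_congr rfl fun _ _ => integral_exp_sq_gaussianReal]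
  simp only [Finset.prod_const, Finset.card_univ, Fintype.card_fin]

/-- For `t` in `V`, pairing with `t` does not see the projection, and the Gaussian characteristic
function depends only on `‖t‖`, which is the same in `V` and in `E`. -/
lemma map_orthogonalProjectionOnto_stdGaussian (V : Submodule ℝ E) :
    (stdGaussian E).map V.orthogonalProjectionOnto = stdGaussian V := by
  apply Measure.ext_of_charFun
  ext t
  rw [charFun_stdGaussian, charFun_apply, integral_map (by fun_prop) (by fun_prop)]
  have h := charFun_stdGaussian (t : E)
  rw [charFun_apply] at h
  simp only [Submodule.coe_norm]
  rw [← h]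
  congr 1
  ext x
  congr 3
  rw [Submodule.coe_inner, ← Submodule.starProjection_apply,
    Submodule.inner_starProjection_left_eq_right, Submodule.starProjection_eq_self_iff.2 t.2]

end StdGaussian

section Noise

variable {Ω : Type*} [MeasurableSpace Ω] {P : Measure Ω} {N : ℕ} {σ : ℝ} {ε : Ω → Signal N}

lemma IsGaussianNoise.aemeasurable (hε : IsGaussianNoise P σ ε) : AEMeasurable ε P := by
  have h : AEMeasurable (fun ω i => ε ω i) P :=
    aemeasurable_pi_iff.2 fun i => (hε.2 i).aemeasurable
  exact (WithLp.measurable_toLp 2 (Fin N → ℝ)).comp_aemeasurable h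

lemma IsGaussianNoise.aemeasurable_inv_smul (hε : IsGaussianNoise P σ ε) :
    AEMeasurable (fun ω => σ⁻¹ • ε ω) P :=
  (hε.aemeasurable.const_smul σ⁻¹ : AEMeasurable (σ⁻¹ • ε) P)

lemma IsGaussianNoise.aemeasurable_projection (hε : IsGaussianNoise P σ ε)
    (V : Submodule ℝ (Signal N)) :
    AEMeasurable (fun ω => V.orthogonalProjectionOnto (σ⁻¹ • ε ω)) P :=
  V.orthogonalProjectionOnto.continuous.measurable.comp_aemeasurable hε.aemeasurable_inv_smul

lemma IsGaussianNoise.map_inv_smul [IsProbabilityMeasure P] (hσ : 0 < σ)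
    (hε : IsGaussianNoise P σ ε) :
    P.map (fun ω => σ⁻¹ • ε ω) = stdGaussian (Signal N) := by
  have hlaw : ∀ i, HasLaw (fun ω => σ⁻¹ * ε ω i) (gaussianReal 0 1) P := by
    intro i
    have h := gaussianReal_const_mul (hε.2 i) σ⁻¹
    rw [mul_zero] at h
    convert h using 2
    ext
    simp only [NNReal.coe_one, NNReal.coe_mul, NNReal.coe_mk]
    rw [Real.coe_toNNReal _ (by positivity)]
    field_simp
  have hind : iIndepFun (fun i ω => σ⁻¹ * ε ω i) P :=
    hε.1.comp (fun _ y => σ⁻¹ * y) fun _ => by fun_prop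
  have hmeas : ∀ i, AEMeasurable (fun ω => σ⁻¹ * ε ω i) P := fun i => (hlaw i).aemeasurable
  have hpi := hind.map_fun_eq_pi_map hmeas
  simp only [fun i => (hlaw i).map_eq] at hpi
  rw [← map_pi_eq_stdGaussian, ← hpi, AEMeasurable.map_map_of_aemeasurable (by fun_prop)
    (aemeasurable_pi_iff.2 hmeas)]
  rfl

lemma IsGaussianNoise.map_projection [IsProbabilityMeasure P] (hσ : 0 < σ)
    (hε : IsGaussianNoise P σ ε) (V : Submodule ℝ (Signal N)) :
    P.map (fun ω => V.orthogonalProjectionOnto (σ⁻¹ • ε ω)) = stdGaussian V := by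
  rw [← map_orthogonalProjectionOnto_stdGaussian, ← hε.map_inv_smul hσ,
    AEMeasurable.map_map_of_aemeasurable (by fun_prop) hε.aemeasurable_inv_smul]
  rfl

lemma norm_projection_inv_smul (hσ : 0 < σ) (V : Submodule ℝ (Signal N)) (x : Signal N) :
    ‖V.orthogonalProjectionOnto (σ⁻¹ • x)‖ ^ 2 / 6 = ‖V.starProjection x‖ ^ 2 / (6 * σ ^ 2) := by
  rw [map_smul, norm_smul, Submodule.starProjection_apply, Submodule.coe_norm, mul_pow,
    Real.norm_of_nonneg (by positivity)]
  field_simp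

lemma IsGaussianNoise.integrable_exp_norm_sq [IsProbabilityMeasure P] (hσ : 0 < σ)
    (hε : IsGaussianNoise P σ ε) (V : Submodule ℝ (Signal N)) :
    Integrable (fun ω => Real.exp (‖V.starProjection (ε ω)‖ ^ 2 / (6 * σ ^ 2))) P := by
  have h := integrable_exp_norm_sq_stdGaussian (E := V)
  rw [← hε.map_projection hσ V, integrable_map_measure (by fun_prop) (hε.aemeasurable_projection V)] at h
  simpa only [Function.comp_def, norm_projection_inv_smul hσ] using h

lemma IsGaussianNoise.integral_exp_norm_sq [IsProbabilityMeasure P] (hσ : 0 < σ)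
    (hε : IsGaussianNoise P σ ε) (V : Submodule ℝ (Signal N)) :
    ∫ ω, Real.exp (‖V.starProjection (ε ω)‖ ^ 2 / (6 * σ ^ 2)) ∂P =
      √(3 / 2) ^ Module.finrank ℝ V := by
  have h := integral_exp_norm_sq_stdGaussian (E := V)
  rw [← hε.map_projection hσ V, integral_map (hε.aemeasurable_projection V) (by fun_prop)] at h
  simpa only [norm_projection_inv_smul hσ] using h

lemma IsGaussianNoise.integrable_norm_sq [IsProbabilityMeasure P] (hσ : 0 < σ)
    (hε : IsGaussianNoise P σ ε) : Integrable (fun ω => ‖ε ω‖ ^ 2) P := by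
  have h := (hε.integrable_exp_norm_sq hσ ⊤).const_mul (6 * σ ^ 2)
  refine h.mono' (hε.aemeasurable.norm.pow_const 2).aestronglyMeasurable
    (Filter.Eventually.of_forall fun ω => ?_)
  have h1 := Real.add_one_le_exp (‖ε ω‖ ^ 2 / (6 * σ ^ 2))
  rw [Real.norm_of_nonneg (by positivity), Submodule.starProjection_top,
    ContinuousLinearMap.id_apply]
  calc ‖ε ω‖ ^ 2 = 6 * σ ^ 2 * (‖ε ω‖ ^ 2 / (6 * σ ^ 2)) := by field_simp
    _ ≤ _ := by gcongr; linarith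

end Noise

/-! ### Dimension of the model spaces -/

/-- Evaluating at one representative of each part is injective on signals constant on the parts. -/
lemma finrank_modelSpace_le {N : ℕ} (m : Model N) :
    Module.finrank ℝ (modelSpace m) ≤ m.parts.card := by
  have hne : ∀ A : m.parts, ∃ i, i ∈ A.1 := fun A => m.nonempty_of_mem_parts A.2
  choose rep hrep using hne
  let φ : modelSpace m →ₗ[ℝ] (m.parts → ℝ) :=
    { toFun := fun f A => f.1 (rep A)
      map_add' := fun _ _ => rfl
      map_smul' := fun _ _ => rfl }
  have hφ : Function.Injective φ := by
    intro f g h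
    refine Subtype.ext (PiLp.ext fun i => ?_)
    have hmem : m.part i ∈ m.parts := m.part_mem.2 (Finset.mem_univ i)
    have hi : i ∈ m.part i := m.mem_part_self.2 (Finset.mem_univ i)
    rw [f.2 _ hmem i hi _ (hrep ⟨_, hmem⟩), g.2 _ hmem i hi _ (hrep ⟨_, hmem⟩)]
    exact congrFun h ⟨_, hmem⟩
  refine (LinearMap.finrank_le_finrank_of_injective hφ).trans_eq ?_
  rw [Module.finrank_fintype_fun_eq_card, Fintype.card_coe]

/-- The space spanned by a model space and a signal. -/
def extendedSpace {N : ℕ} (f : Signal N) (m : Model N) : Submodule ℝ (Signal N) :=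
  modelSpace m ⊔ Submodule.span ℝ {f}

lemma finrank_extendedSpace_le {N : ℕ} (hN : 0 < N) (f : Signal N) (m : Model N) :
    Module.finrank ℝ (extendedSpace f m) ≤ clusterDim m + 2 := by
  have h1 := Submodule.finrank_add_le_finrank_add_finrank (modelSpace m) (Submodule.span ℝ {f})
  have h2 := finrank_modelSpace_le m
  have h3 := finrank_span_le_card (R := ℝ) ({f} : Set (Signal N))
  rw [parts_card_eq hN] at h2
  simp only [Set.toFinset_singleton, Finset.card_singleton] at h3
  unfold extendedSpace
  omega

/-! ### The oracle inequality -/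

lemma sq_norm_projEst_sub_le {N : ℕ} {f e : Signal N} {m mstar : Model N} {c p q : ℝ}
    (hf : f ∈ modelSpace mstar)
    (h : ‖f + e - projEst m (f + e)‖ ^ 2 + c * p ≤
      ‖f + e - projEst mstar (f + e)‖ ^ 2 + c * q) :
    ‖projEst m (f + e) - f‖ ^ 2 ≤
      2 * (c * q) + 4 * ‖(extendedSpace f m).starProjection e‖ ^ 2 - 2 * (c * p) := by
  have h1 : ‖f + e - projEst mstar (f + e)‖ ^ 2 ≤ ‖e‖ ^ 2 := by
    have : f + e - projEst mstar (f + e) = (modelSpace mstar)ᗮ.starProjection e := by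
      rw [projEst, map_add, Submodule.starProjection_eq_self_iff.2 hf,
        Submodule.starProjection_orthogonal_val]
      abel
    rw [this]
    gcongr
    exact Submodule.norm_starProjection_apply_le _ _
  set g := projEst m (f + e) with hg
  have hmem : g - f ∈ extendedSpace f m := by
    refine Submodule.sub_mem _ (Submodule.mem_sup_left ?_) (Submodule.mem_sup_right ?_)
    · exact Submodule.starProjection_apply_mem _ _
    · exact Submodule.mem_span_singleton_self f
  have h2 : inner ℝ e (g - f) = inner ℝ ((extendedSpace f m).starProjection e) (g - f) := by
    rw [Submodule.inner_starProjection_left_eq_right,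
      Submodule.starProjection_eq_self_iff.2 hmem]
  have h3 := real_inner_le_norm ((extendedSpace f m).starProjection e) (g - f)
  have h4 : ‖f + e - g‖ ^ 2 = ‖e‖ ^ 2 - 2 * inner ℝ e (g - f) + ‖g - f‖ ^ 2 := by
    rw [← norm_sub_sq_real]
    congr 2
    abel
  -- The square encodes `2 ‖Π e‖ ‖g - f‖ ≤ ‖g - f‖² / 2 + 2 ‖Π e‖²`; half of the error is absorbed
  -- on the left, which doubles the other terms.
  nlinarith [sq_nonneg (‖g - f‖ - 2 * ‖(extendedSpace f m).starProjection e‖)]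

/-- The criterion is finite at `mstar`, so a minimiser cannot have infinite penalty, and the
comparison descends from `EReal` to the reals. -/
lemma IsSelected.clusterDim_pos_and_le {N : ℕ} {σ K : ℝ} (hσ : 0 < σ) (hK : 0 < K)
    {y : Signal N} {m mstar : Model N} (h : IsSelected σ K y m) (hmem : mstar ∈ candidates N)
    (hd : 1 ≤ clusterDim mstar) :
    1 ≤ clusterDim m ∧ ‖y - projEst m y‖ ^ 2 + σ ^ 2 * K * penReal m ≤
      ‖y - projEst mstar y‖ ^ 2 + σ ^ 2 * K * penReal mstar := by
  have hle := h.2 mstar hmem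
  have hpos : 0 < σ ^ 2 * K := by positivity
  unfold crit at hle
  rw [pen_eq_penReal (m := mstar) (by omega), ← EReal.coe_mul, ← EReal.coe_add] at hle
  by_cases h0 : clusterDim m = 0
  · rw [pen_eq_top h0, EReal.coe_mul_top_of_pos hpos, EReal.coe_add_top, top_le_iff] at hle
    exact absurd hle (EReal.coe_ne_top _)
  · rw [pen_eq_penReal h0, ← EReal.coe_mul, ← EReal.coe_add, EReal.coe_le_coe_iff] at hle
    exact ⟨by omega, hle⟩

open scoped Classical in
/-- The candidate models with a finite penalty. -/
noncomputable def properCandidates (N : ℕ) : Finset (Model N) :=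
  Finset.univ.filter fun m => m ∈ candidates N ∧ 1 ≤ clusterDim m

lemma mem_properCandidates {N : ℕ} {m : Model N} :
    m ∈ properCandidates N ↔ m ∈ candidates N ∧ 1 ≤ clusterDim m := by
  simp [properCandidates]

lemma sq_norm_projEst_sub_le_sum_exp {N : ℕ} {σ : ℝ} (hσ : 0 < σ) {f e : Signal N}
    {m mstar : Model N} (hf : f ∈ modelSpace mstar) (hmem : mstar ∈ candidates N)
    (hd : 1 ≤ clusterDim mstar) (h : IsSelected σ (3 * 2) (f + e) m) :
    ‖projEst m (f + e) - f‖ ^ 2 ≤ 12 * σ ^ 2 * penReal mstar +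
      24 * σ ^ 2 * ∑ m' ∈ properCandidates N,
        Real.exp (‖(extendedSpace f m').starProjection e‖ ^ 2 / (6 * σ ^ 2)) *
          (Real.exp (-(penReal m' / 2)) * Real.exp (-1)) := by
  obtain ⟨hm, hle⟩ := h.clusterDim_pos_and_le hσ (by norm_num) hmem hd
  have h1 := sq_norm_projEst_sub_le hf hle
  set p := ‖(extendedSpace f m).starProjection e‖ ^ 2 with hp
  have h2 : p / (6 * σ ^ 2) - penReal m / 2 ≤
      Real.exp (p / (6 * σ ^ 2)) * (Real.exp (-(penReal m / 2)) * Real.exp (-1)) := by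
    -- The shift by `-1` turns `x + 1 ≤ exp x` into `x ≤ exp (x - 1)` and gains the factor `exp
    -- (-1)`.
    have := Real.add_one_le_exp (p / (6 * σ ^ 2) + (-(penReal m / 2) + -1))
    rw [Real.exp_add, Real.exp_add] at this
    linarith
  have h3 : Real.exp (p / (6 * σ ^ 2)) * (Real.exp (-(penReal m / 2)) * Real.exp (-1)) ≤
      ∑ m' ∈ properCandidates N,
        Real.exp (‖(extendedSpace f m').starProjection e‖ ^ 2 / (6 * σ ^ 2)) *
          (Real.exp (-(penReal m' / 2)) * Real.exp (-1)) :=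
    Finset.single_le_sum (f := fun m' =>
        Real.exp (‖(extendedSpace f m').starProjection e‖ ^ 2 / (6 * σ ^ 2)) *
          (Real.exp (-(penReal m' / 2)) * Real.exp (-1)))
      (fun _ _ => by positivity) (mem_properCandidates.2 ⟨h.1, hm⟩)
  have h4 : 24 * σ ^ 2 * (p / (6 * σ ^ 2) - penReal m / 2) =
      4 * p - 12 * σ ^ 2 * penReal m := by
    field_simp
    ring
  have h5 := mul_le_mul_of_nonneg_left (h2.trans h3) (show 0 ≤ 24 * σ ^ 2 by positivity)
  linarith

/-- Each of `k + 1 ≥ 2` factors `√(3/2)` is paired with one `exp (-1/2)`, with product at most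
`3/4`; one `√(3/2)` and `exp (-1)` remain. -/
lemma sqrt_pow_mul_exp_le {k : ℕ} (hk : 1 ≤ k) :
    √(3 / 2) ^ (k + 2) * (Real.exp (-(((k : ℝ) + 1) / 2)) * Real.exp (-1)) ≤ 1 / 3 := by
  have ha : √(3 / 2 : ℝ) ≤ 1.225 := by
    rw [Real.sqrt_le_left (by norm_num)]
    norm_num
  have he := Real.exp_neg_one_lt_d9
  have hb : Real.exp (-(1 / 2)) ≤ 0.61 := by
    refine abs_le_of_sq_le_sq' ?_ (by norm_num) |>.2
    rw [← Real.exp_nat_mul]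
    norm_num at he ⊢
    linarith
  have hab : √(3 / 2) * Real.exp (-(1 / 2)) ≤ 3 / 4 := by
    calc √(3 / 2) * Real.exp (-(1 / 2)) ≤ 1.225 * 0.61 := by gcongr
      _ ≤ 3 / 4 := by norm_num
  have hexp : Real.exp (-(((k : ℝ) + 1) / 2)) = Real.exp (-(1 / 2)) ^ (k + 1) := by
    rw [← Real.exp_nat_mul]
    congr 1
    push_cast
    ring
  calc √(3 / 2) ^ (k + 2) * (Real.exp (-(((k : ℝ) + 1) / 2)) * Real.exp (-1))
      = √(3 / 2) * (√(3 / 2) * Real.exp (-(1 / 2))) ^ (k + 1) * Real.exp (-1) := by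
        rw [hexp]; ring
    _ ≤ 1.225 * (3 / 4) ^ (k + 1) * 0.368 := by
        gcongr
        linarith
    _ ≤ 1.225 * (3 / 4) ^ 2 * 0.368 := by
        gcongr ?_ * ?_ * ?_
        exact pow_le_pow_of_le_one (by norm_num) (by norm_num) (by omega)
    _ ≤ 1 / 3 := by norm_num

section Risk

variable {Ω : Type*} [MeasurableSpace Ω] {P : Measure Ω} [IsProbabilityMeasure P] {N : ℕ}
  {σ K : ℝ} {fstar : Signal N} {ε : Ω → Signal N} {mhat : Ω → Model N}

lemma integrable_norm_projEst_sub_sq (hσ : 0 < σ) (hε : IsGaussianNoise P σ ε) (m : Model N) :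
    Integrable (fun ω => ‖projEst m (fstar + ε ω) - fstar‖ ^ 2) P := by
  have hint := ((hε.integrable_norm_sq hσ).const_mul 2).add
    (integrable_const (2 * ‖projEst m fstar - fstar‖ ^ 2))
  have hmeas : AEMeasurable (fun ω => ‖projEst m (fstar + ε ω) - fstar‖ ^ 2) P :=
    ((((modelSpace m).starProjection.continuous.measurable.comp_aemeasurable
      (hε.aemeasurable.const_add fstar)).sub_const fstar).norm).pow_const 2
  refine hint.mono' hmeas.aestronglyMeasurable (Filter.Eventually.of_forall fun ω => ?_)
  rw [Real.norm_of_nonneg (by positivity)]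
  have h1 : projEst m (fstar + ε ω) - fstar = projEst m (ε ω) + (projEst m fstar - fstar) := by
    simp only [projEst, map_add]
    abel
  have h2 : ‖projEst m (ε ω)‖ ≤ ‖ε ω‖ := Submodule.norm_starProjection_apply_le _ _
  have h3 := norm_add_le (projEst m (ε ω)) (projEst m fstar - fstar)
  rw [h1]
  simp only [Pi.add_apply]
  have h4 : ‖projEst m (ε ω) + (projEst m fstar - fstar)‖ ^ 2 ≤
      (‖ε ω‖ + ‖projEst m fstar - fstar‖) ^ 2 := by
    gcongr
    linarith
  nlinarith [sq_nonneg (‖ε ω‖ - ‖projEst m fstar - fstar‖)]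

/-- There are finitely many models, so the error is a finite sum of integrable functions cut off to
the events `mhat = m`. -/
lemma integrable_sqError (hσ : 0 < σ) (hε : IsGaussianNoise P σ ε)
    (hsel : IsSelector P σ K (fun ω => fstar + ε ω) mhat) :
    Integrable (sqError fstar (fun ω => fstar + ε ω) mhat) P := by
  have h : sqError fstar (fun ω => fstar + ε ω) mhat = fun ω => ∑ m : Model N,
      (mhat ⁻¹' {m}).indicator (fun ω => ‖projEst m (fstar + ε ω) - fstar‖ ^ 2) ω := by
    funext ω
    rw [Finset.sum_eq_single (mhat ω)]
    · simp [sqError]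
    · intro m _ hm
      refine Set.indicator_of_notMem ?_ _
      exact fun hmem => hm (Eq.symm hmem)
    · intro hm
      exact absurd (Finset.mem_univ _) hm
  rw [h]
  exact integrable_finsetSum _ fun m _ =>
    (integrable_norm_projEst_sub_sq hσ hε m).indicator₀ (hsel.1 m)

lemma integral_sqError_le_penReal (hσ : 0 < σ) {mstar : Model N} (hN : 0 < N)
    (hf : fstar ∈ modelSpace mstar) (hmem : mstar ∈ candidates N) (hd : 1 ≤ clusterDim mstar)
    (hε : IsGaussianNoise P σ ε)
    (hsel : IsSelector P σ (3 * 2) (fun ω => fstar + ε ω) mhat) :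
    ∫ ω, sqError fstar (fun ω => fstar + ε ω) mhat ω ∂P ≤
      2 * σ ^ 2 * (6 * penReal mstar + 4) := by
  have hint : ∀ m ∈ properCandidates N, Integrable (fun ω =>
      Real.exp (‖(extendedSpace fstar m).starProjection (ε ω)‖ ^ 2 / (6 * σ ^ 2)) *
          (Real.exp (-(penReal m / 2)) * Real.exp (-1))) P := fun m _ =>
    (hε.integrable_exp_norm_sq hσ _).mul_const _
  have hsum := integrable_finsetSum _ hint
  have hterm : ∀ m ∈ properCandidates N, ∫ ω,
      Real.exp (‖(extendedSpace fstar m).starProjection (ε ω)‖ ^ 2 / (6 * σ ^ 2)) *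
          (Real.exp (-(penReal m / 2)) * Real.exp (-1)) ∂P ≤ prior m * (1 / 3) := by
    intro m hm
    obtain ⟨hm1, hm2⟩ := mem_properCandidates.1 hm
    rw [integral_mul_const, hε.integral_exp_norm_sq hσ]
    have hone : 1 ≤ √(3 / 2 : ℝ) := Real.one_le_sqrt.2 (by norm_num)
    have hp := prior_pos hN m
    calc √(3 / 2) ^ Module.finrank ℝ (extendedSpace fstar m) *
          (Real.exp (-(penReal m / 2)) * Real.exp (-1))
        ≤ √(3 / 2) ^ (clusterDim m + 2) *
          ((prior m * Real.exp (-(((clusterDim m : ℝ) + 1) / 2))) * Real.exp (-1)) := by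
          gcongr
          · exact finrank_extendedSpace_le hN fstar m
          · exact exp_neg_half_penReal_le m hm2 hm1 hN
      _ = prior m * (√(3 / 2) ^ (clusterDim m + 2) *
          (Real.exp (-(((clusterDim m : ℝ) + 1) / 2)) * Real.exp (-1))) := by ring
      _ ≤ prior m * (1 / 3) := by
          gcongr
          exact sqrt_pow_mul_exp_le hm2
  have htotal : ∑ m ∈ properCandidates N, prior m * (1 / 3) ≤ 1 / 3 := by
    rw [← Finset.sum_mul]
    have : ∑ m ∈ properCandidates N, prior m ≤ 1 := by
      rw [← sum_prior hN]
      exact Finset.sum_le_sum_of_subset_of_nonneg (Finset.subset_univ _)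
        fun m _ _ => (prior_pos hN m).le
    linarith
  calc ∫ ω, sqError fstar (fun ω => fstar + ε ω) mhat ω ∂P
      ≤ ∫ ω, (12 * σ ^ 2 * penReal mstar + 24 * σ ^ 2 * ∑ m ∈ properCandidates N,
          Real.exp (‖(extendedSpace fstar m).starProjection (ε ω)‖ ^ 2 / (6 * σ ^ 2)) *
            (Real.exp (-(penReal m / 2)) * Real.exp (-1))) ∂P := by
        refine integral_mono (integrable_sqError hσ hε hsel)
          ((integrable_const _).add (hsum.const_mul _)) fun ω => ?_
        exact sq_norm_projEst_sub_le_sum_exp hσ hf hmem hd (hsel.2 ω)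
    _ = 12 * σ ^ 2 * penReal mstar + 24 * σ ^ 2 * ∑ m ∈ properCandidates N, ∫ ω,
          Real.exp (‖(extendedSpace fstar m).starProjection (ε ω)‖ ^ 2 / (6 * σ ^ 2)) *
            (Real.exp (-(penReal m / 2)) * Real.exp (-1)) ∂P := by
        rw [integral_add (integrable_const _) (hsum.const_mul _), integral_const,
          integral_const_mul, integral_finsetSum _ hint]
        simp
    _ ≤ 12 * σ ^ 2 * penReal mstar + 24 * σ ^ 2 * (1 / 3) := by
        gcongr
        exact (Finset.sum_le_sum hterm).trans htotal
    _ = 2 * σ ^ 2 * (6 * penReal mstar + 4) := by ring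

lemma integral_sqError_le (hσ : 0 < σ) {mstar : Model N}
    (hf : fstar ∈ modelSpace mstar) (hmem : mstar ∈ candidates N) (hd : 1 ≤ clusterDim mstar)
    (hε : IsGaussianNoise P σ ε)
    (hsel : IsSelector P σ (3 * 2) (fun ω => fstar + ε ω) mhat) :
    ∫ ω, sqError fstar (fun ω => fstar + ε ω) mhat ω ∂P ≤
      4 * σ ^ 2 * (7
        + 3 * ((clusterDim mstar : ℝ) + 1) * Real.log ((N : ℝ) / (clusterDim mstar : ℝ))
        + 6 * ((clusterDim mstar : ℝ) *
              Real.log ((changeDim mstar : ℝ) * Real.exp (13 / 6))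
            + (changeDim mstar : ℝ) * Real.log ((clusterDim mstar : ℝ) * Real.exp 2)
            + (changeDim mstar : ℝ) * Real.log ((N : ℝ) / (changeDim mstar : ℝ)))) := by
  have hN : 0 < N := by
    have h1 : (1 : ℝ) ≤ clusterDim mstar := by exact_mod_cast hd
    have h2 : Real.exp 1 * (clusterDim mstar : ℝ) ≤ N := hmem
    have h3 : 0 < Real.exp 1 * (clusterDim mstar : ℝ) := by positivity
    exact_mod_cast h3.trans_le h2
  refine (integral_sqError_le_penReal hσ hN hf hmem hd hε hsel).trans ?_
  have := mul_le_mul_of_nonneg_left (penReal_le mstar hd hN) (show 0 ≤ 2 * σ ^ 2 by positivity)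
  linarith

end Risk

/-! ### Consistency -/

/-- Every model space is contained in the space of a model with a finite penalty and at most one
more change point. -/
lemma exists_modelSpace_le {N : ℕ} (hN : 2 ≤ N) (m : Model N) :
    ∃ m' : Model N, modelSpace m ≤ modelSpace m' ∧ 1 ≤ clusterDim m' ∧
      changeDim m' ≤ changeDim m + 1 := by
  by_cases hd : 1 ≤ clusterDim m
  · exact ⟨m, le_rfl, hd, Nat.le_succ _⟩
  have hcard : m.parts.card ≤ 1 := by
    rw [parts_card_eq (by omega)]
    omega
  -- The first point is separated from all the others; its only change point is `0`.
  obtain ⟨Q, hQ⟩ := exists_finpartition_part_iff (fun i : Fin N => decide ((i : ℕ) = 0))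
  refine ⟨Q, fun f hf A _ i _ j _ => ?_, ?_, ?_⟩
  · have hi := m.part_mem.2 (Finset.mem_univ i)
    have hj := m.part_mem.2 (Finset.mem_univ j)
    have hij : m.part i = m.part j := Finset.card_le_one.1 hcard _ hi _ hj
    refine hf _ hi i (m.mem_part_self.2 (Finset.mem_univ i)) j ?_
    rw [hij]
    exact m.mem_part_self.2 (Finset.mem_univ j)
  · have h : 1 < Q.parts.card := by
      refine Finset.one_lt_card.2 ⟨_, Q.part_mem.2 (Finset.mem_univ ⟨0, by omega⟩), _,
        Q.part_mem.2 (Finset.mem_univ ⟨1, by omega⟩), fun h => ?_⟩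
      have := (hQ _ _).1 h
      simp at this
    rw [parts_card_eq (by omega)] at h
    omega
  · have hsub : changePoints Q ⊆ {⟨0, by omega⟩} := by
      intro i hi
      obtain ⟨j, hj, hne⟩ := mem_changePoints.1 hi
      rw [Ne, hQ] at hne
      have hj0 : (j : ℕ) ≠ 0 := by omega
      simp only [hj0, decide_false, decide_eq_false_iff_not, not_not] at hne
      exact Finset.mem_singleton.2 (Fin.ext hne)
    have := Finset.card_le_card hsub
    rw [Finset.card_singleton] at this
    unfold changeDim
    omega

/-- All dimensions are replaced by `n` and all logarithms by `ln N`, which is at least one since `N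
≥ 3 > e`; then `56 = 7 + 3 * 2 + 6 * (1 + 13/6 + 1 + 2 + 1)`. -/
lemma riskBound_le {k n N : ℕ} (hk : 1 ≤ k) (hkn : k ≤ n) (hnN : n ≤ N) (hN : 3 ≤ N) :
    7 + 3 * ((k : ℝ) + 1) * Real.log ((N : ℝ) / (k : ℝ))
      + 6 * ((k : ℝ) * Real.log ((n : ℝ) * Real.exp (13 / 6))
        + (n : ℝ) * Real.log ((k : ℝ) * Real.exp 2)
        + (n : ℝ) * Real.log ((N : ℝ) / (n : ℝ))) ≤ 56 * (n * Real.log N) := by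
  have hk' : (1 : ℝ) ≤ k := by exact_mod_cast hk
  have hkn' : (k : ℝ) ≤ n := by exact_mod_cast hkn
  have hnN' : (n : ℝ) ≤ N := by exact_mod_cast hnN
  have hN' : (3 : ℝ) ≤ N := by exact_mod_cast hN
  have hL : 1 ≤ Real.log N := by
    rw [← Real.log_exp 1]
    exact Real.log_le_log (Real.exp_pos 1) (by linarith [Real.exp_one_lt_three])
  have hn : (1 : ℝ) ≤ n := hk'.trans hkn'
  have h1 : Real.log ((N : ℝ) / k) ≤ Real.log N :=
    Real.log_le_log (by positivity) (div_le_self (by linarith) hk')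
  have h2 : Real.log ((N : ℝ) / n) ≤ Real.log N :=
    Real.log_le_log (by positivity) (div_le_self (by linarith) hn)
  have h3 : Real.log n ≤ Real.log N := Real.log_le_log (by linarith) hnN'
  have h4 : Real.log k ≤ Real.log N := Real.log_le_log (by linarith) (hkn'.trans hnN')
  rw [Real.log_mul (by positivity) (by positivity), Real.log_mul (by positivity) (by positivity),
    Real.log_exp, Real.log_exp]
  have a1 : ((k : ℝ) + 1) * Real.log ((N : ℝ) / k) ≤ (2 * n) * Real.log N := by
    calc ((k : ℝ) + 1) * Real.log ((N : ℝ) / k) ≤ ((k : ℝ) + 1) * Real.log N := by gcongr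
      _ ≤ (2 * n) * Real.log N := by gcongr; linarith
  have a2 : (k : ℝ) * (Real.log n + 13 / 6) ≤ n * (Real.log N + 13 / 6) := by
    calc (k : ℝ) * (Real.log n + 13 / 6) ≤ k * (Real.log N + 13 / 6) := by gcongr
      _ ≤ n * (Real.log N + 13 / 6) := by gcongr
  have a3 : (n : ℝ) * (Real.log k + 2) ≤ n * (Real.log N + 2) := by gcongr
  have a4 : (n : ℝ) * Real.log ((N : ℝ) / n) ≤ n * Real.log N := by gcongr
  have a5 : (n : ℝ) ≤ n * Real.log N := le_mul_of_one_le_right (by linarith) hL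
  linarith

lemma integral_sqError_le_of_changeDim {Ω : Type*} [MeasurableSpace Ω] {P : Measure Ω}
    [IsProbabilityMeasure P] {N : ℕ} {σ : ℝ} {fstar : Signal N} {ε : Ω → Signal N}
    {mhat : Ω → Model N} {mstar : Model N} (hσ : 0 < σ) (hN : 3 ≤ N)
    (hf : fstar ∈ modelSpace mstar) (hε : IsGaussianNoise P σ ε)
    (hsel : IsSelector P σ (3 * 2) (fun ω => fstar + ε ω) mhat)
    (hsmall : 3 * ((changeDim mstar : ℝ) + 1) ≤ N) :
    ∫ ω, sqError fstar (fun ω => fstar + ε ω) mhat ω ∂P ≤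
      224 * σ ^ 2 * (((changeDim mstar : ℝ) + 1) * Real.log N) := by
  obtain ⟨m, hle, hd, hn⟩ := exists_modelSpace_le (by omega) mstar
  have hkn := clusterDim_le_changeDim (by omega) m
  have hn' : (changeDim m : ℝ) ≤ changeDim mstar + 1 := by exact_mod_cast hn
  have hmem : m ∈ candidates N := by
    have hk' : (clusterDim m : ℝ) ≤ changeDim m := by exact_mod_cast hkn
    calc Real.exp 1 * (clusterDim m : ℝ) ≤ 3 * ((changeDim mstar : ℝ) + 1) := by
          gcongr
          · exact Real.exp_one_lt_three.le
          · exact hk'.trans hn'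
      _ ≤ N := hsmall
  have h1 := integral_sqError_le hσ (hle hf) hmem hd hε hsel
  have h2 := riskBound_le hd hkn (changeDim_le m) hN
  have hlog : 0 ≤ Real.log N := Real.log_natCast_nonneg N
  calc ∫ ω, sqError fstar (fun ω => fstar + ε ω) mhat ω ∂P
      ≤ 4 * σ ^ 2 * (56 * (changeDim m * Real.log N)) :=
        h1.trans (mul_le_mul_of_nonneg_left h2 (by positivity))
    _ ≤ 4 * σ ^ 2 * (56 * (((changeDim mstar : ℝ) + 1) * Real.log N)) := by gcongr
    _ = 224 * σ ^ 2 * (((changeDim mstar : ℝ) + 1) * Real.log N) := by ring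

lemma tendsto_add_one_mul_log_div {d : ℕ → ℝ}
    (hd : d =o[atTop] fun N : ℕ => (N : ℝ) / Real.log (N : ℝ)) :
    Tendsto (fun N : ℕ => (d N + 1) * Real.log N / N) atTop (𝓝 0) := by
  have h1 : Tendsto (fun N : ℕ => d N * Real.log N / N) atTop (𝓝 0) := by
    refine hd.tendsto_div_nhds_zero.congr fun N => ?_
    rw [div_div_eq_mul_div]
  have h2 : Tendsto (fun N : ℕ => Real.log N / N) atTop (𝓝 0) :=
    Real.isLittleO_log_id_atTop.tendsto_div_nhds_zero.comp tendsto_natCast_atTop_atTop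
  have h3 := h1.add h2
  rw [add_zero] at h3
  refine h3.congr fun N => ?_
  ring

lemma tendsto_integral_sqError {σ : ℝ} (hσ : 0 < σ) {Ω : ℕ → Type*}
    [∀ N, MeasurableSpace (Ω N)] (P : ∀ N, Measure (Ω N)) [∀ N, IsProbabilityMeasure (P N)]
    {fstar : ∀ N, Signal N} {mstar : ∀ N, Model N}
    {ε : ∀ N, Ω N → Signal N} {mhat : ∀ N, Ω N → Model N}
    (hf : ∀ N, fstar N ∈ modelSpace (mstar N)) (hε : ∀ N, IsGaussianNoise (P N) σ (ε N))
    (hsel : ∀ N, IsSelector (P N) σ (3 * 2) (fun ω => fstar N + ε N ω) (mhat N))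
    (hd : (fun N : ℕ => (changeDim (mstar N) : ℝ)) =o[atTop]
      fun N : ℕ => (N : ℝ) / Real.log (N : ℝ)) :
    Tendsto (fun N : ℕ => (1 / (N : ℝ)) *
      ∫ ω, sqError (fstar N) (fun ω => fstar N + ε N ω) (mhat N) ω ∂(P N)) atTop (𝓝 0) := by
  have hlim := tendsto_add_one_mul_log_div hd
  have hlim' := hlim.const_mul (224 * σ ^ 2)
  rw [mul_zero] at hlim'
  refine squeeze_zero' (Eventually.of_forall fun N => ?_) ?_ hlim'
  · exact mul_nonneg (by positivity) (integral_nonneg fun ω => sq_nonneg _)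
  -- The same limit serves twice: as the final bound, and, with `ln N ≥ 1`, to ensure `3 (d'' + 1) ≤
  -- N`, which makes the refined model a candidate.
  filter_upwards [hlim.eventually_le_const (show (0 : ℝ) < 1 / 3 by norm_num),
    eventually_ge_atTop 3] with N hN hN3
  have hN3' : (3 : ℝ) ≤ N := by exact_mod_cast hN3
  have hN0 : (0 : ℝ) < N := by linarith
  have hL : 1 ≤ Real.log N := by
    rw [← Real.log_exp 1]
    exact Real.log_le_log (Real.exp_pos 1) (by linarith [Real.exp_one_lt_three])
  have hsmall : 3 * ((changeDim (mstar N) : ℝ) + 1) ≤ N := by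
    rw [div_le_iff₀ hN0] at hN
    have : (changeDim (mstar N) : ℝ) + 1 ≤ ((changeDim (mstar N) : ℝ) + 1) * Real.log N :=
      le_mul_of_one_le_right (by positivity) hL
    linarith
  have h := integral_sqError_le_of_changeDim hσ hN3 (hf N) (hε N) (hsel N) hsmall
  calc (1 / (N : ℝ)) * ∫ ω, sqError (fstar N) (fun ω => fstar N + ε N ω) (mhat N) ω ∂(P N)
      ≤ (1 / (N : ℝ)) *
        (224 * σ ^ 2 * (((changeDim (mstar N) : ℝ) + 1) * Real.log N)) := by gcongr
    _ = 224 * σ ^ 2 * (((changeDim (mstar N) : ℝ) + 1) * Real.log N / N) := by ring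

end ChangeCluster

theorem corollary6p1 (σ : ℝ) (hσ : 0 < σ) :
    -- adaptation and risk upper bound, for a fixed number `N` of observations
    (∀ {Ω : Type*} [MeasurableSpace Ω] (P : Measure Ω) [IsProbabilityMeasure P] (N : ℕ)
      (fstar : ChangeCluster.Signal N) (mstar : ChangeCluster.Model N)
      (ε : Ω → ChangeCluster.Signal N) (mhat : Ω → ChangeCluster.Model N),
      fstar ∈ ChangeCluster.modelSpace mstar →
      mstar ∈ ChangeCluster.candidates N →
      1 ≤ ChangeCluster.clusterDim mstar →
      ChangeCluster.IsGaussianNoise P σ ε →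
      ChangeCluster.IsSelector P σ (3 * 2) (fun ω => fstar + ε ω) mhat →
      Integrable (ChangeCluster.sqError fstar (fun ω => fstar + ε ω) mhat) P ∧
      ∫ ω, ChangeCluster.sqError fstar (fun ω => fstar + ε ω) mhat ω ∂P ≤
        4 * σ ^ 2 * (7
          + 3 * ((ChangeCluster.clusterDim mstar : ℝ) + 1) *
              Real.log ((N : ℝ) / (ChangeCluster.clusterDim mstar : ℝ))
          + 6 * ((ChangeCluster.clusterDim mstar : ℝ) *
                Real.log ((ChangeCluster.changeDim mstar : ℝ) * Real.exp (13 / 6))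
              + (ChangeCluster.changeDim mstar : ℝ) *
                Real.log ((ChangeCluster.clusterDim mstar : ℝ) * Real.exp 2)
              + (ChangeCluster.changeDim mstar : ℝ) *
                Real.log ((N : ℝ) / (ChangeCluster.changeDim mstar : ℝ))))) ∧
    -- consistency, as the number `N` of observations tends to infinity
    (∀ {Ω : ℕ → Type*} [∀ N, MeasurableSpace (Ω N)] (P : ∀ N, Measure (Ω N))
      [∀ N, IsProbabilityMeasure (P N)]
      (fstar : ∀ N, ChangeCluster.Signal N) (mstar : ∀ N, ChangeCluster.Model N)
      (ε : ∀ N, Ω N → ChangeCluster.Signal N) (mhat : ∀ N, Ω N → ChangeCluster.Model N),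
      (∀ N, fstar N ∈ ChangeCluster.modelSpace (mstar N)) →
      (∀ N, ChangeCluster.IsGaussianNoise (P N) σ (ε N)) →
      (∀ N, ChangeCluster.IsSelector (P N) σ (3 * 2) (fun ω => fstar N + ε N ω) (mhat N)) →
      (fun N : ℕ => (ChangeCluster.changeDim (mstar N) : ℝ)) =o[atTop]
        (fun N : ℕ => (N : ℝ) / Real.log (N : ℝ)) →
      (∀ N, Integrable
        (ChangeCluster.sqError (fstar N) (fun ω => fstar N + ε N ω) (mhat N)) (P N)) ∧
      Tendsto (fun N : ℕ => (1 / (N : ℝ)) *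
        ∫ ω, ChangeCluster.sqError (fstar N) (fun ω => fstar N + ε N ω) (mhat N) ω ∂(P N))
        atTop (𝓝 0)) := by
  refine ⟨?_, ?_⟩
  · intro Ω _ P _ N fstar mstar ε mhat hf hmem hd hε hsel
    exact ⟨ChangeCluster.integrable_sqError hσ hε hsel,
      ChangeCluster.integral_sqError_le hσ hf hmem hd hε hsel⟩
  · intro Ω _ P _ fstar mstar ε mhat hf hε hsel hd
    exact ⟨fun N => ChangeCluster.integrable_sqError hσ (hε N) (hsel N),
      ChangeCluster.tendsto_integral_sqError hσ P hf hε hsel hd⟩
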